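/- All rings are commutative with unit and local rings need not be Noetherian. For a polynomial $f\in R[x]$ let $c(f)$ be the ideal of $R$ generated by the coefficients of $f$; the ring $R$ is called Gaussian if $c(f)\,c(g)=c(fg)$ for all $f,g\in R[x]$. For an $R$-module $M$, let $\mathrm{wgd}_R(M)$ be the least integer $n\ge 0$ such that there is an exact sequence $0\to F_n\to\cdots\to F_1\to F_0\to M\to 0$ with all $F_i$ flat $R$-modules, and $\mathrm{wgd}_R(M)=\infty$ if there is no such $n$. The weak global dimension of $R$ is $\mathrm{wgd}(R)=\sup\{\mathrm{wgd}_R(M) : M \text{ an } R\text{-module}\}$. **Theorem.** Let $(R,\mathfrak m)$ be a local Gaussian ring whose nilradical is equal to its maximal ideal $\mathfrak m$. If $\mathfrak m$ is not nilpotent (that is, $\mathfrak m^k\neq 0$ for every $k\geq 1$), then $\mathrm{wgd}(R)=\infty$. -/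

import Mathlib

universe u

/-- A polynomial `f` over `R` is Gaussian if `c(f) c(g) = c(fg)` for every polynomial `g`, where
`c` denotes the content, the ideal generated by the coefficients. -/
def IsGaussianPolynomial {R : Type u} [CommRing R] (f : Polynomial R) : Prop :=
  ∀ g : Polynomial R, f.contentIdeal * g.contentIdeal = (f * g).contentIdeal

/-- A commutative ring is Gaussian if every polynomial over it is Gaussian. -/
def IsGaussianRing (R : Type u) [CommRing R] : Prop :=
  ∀ f : Polynomial R, IsGaussianPolynomial f

/-- A resolution `0 → F n → ⋯ → F 1 → F 0 → M → 0` of the `R`-module `M` by flat `R`-modules,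
extended by zero modules in the degrees above `n`. -/
structure FlatResolution (R : Type u) [CommRing R] (M : Type u) [AddCommGroup M] [Module R M]
    (n : ℕ) where
  /-- the modules of the resolution -/
  F : ℕ → ModuleCat.{u} R
  /-- the differentials -/
  d : ∀ i : ℕ, F (i + 1) →ₗ[R] F i
  /-- the augmentation -/
  ε : F 0 →ₗ[R] M
  flat : ∀ i : ℕ, Module.Flat R (F i)
  subsingleton_of_lt : ∀ i : ℕ, n < i → Subsingleton (F i)
  surjective_augmentation : Function.Surjective ε
  exact_augmentation : Function.Exact (d 0) ε
  exact_differential : ∀ i : ℕ, Function.Exact (d (i + 1)) (d i)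

/-- The weak global dimension of an `R`-module `M` (its flat dimension): the least `n` such that
`M` has a resolution by flat modules of length `n`, and `⊤` if there is no such `n`. -/
noncomputable def moduleWgd (R : Type u) [CommRing R] (M : Type u) [AddCommGroup M]
    [Module R M] : ℕ∞ :=
  ⨅ (n : ℕ) (_ : Nonempty (FlatResolution R M n)), (n : ℕ∞)

/-- The weak global dimension of a commutative ring `R`: the supremum of the weak global
dimensions of its modules. -/
noncomputable def wgd (R : Type u) [CommRing R] : ℕ∞ :=
  ⨆ M : ModuleCat.{u} R, moduleWgd R M

universe v

/-! In a local Gaussian ring divisibility is total up to square-zero errors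
(`IsGaussianRing.isQuasiChainRing`). The square-zero elements form an ideal `N` with `N² = 0`. For
nilpotent `a` with `a² ≠ 0`, the annihilator of `a` lies in `N` and the ideal `(a)` is uniserial
(`IsQuasiChainRing.dvd_or_dvd`). As `m` is nil but not nilpotent, it is not principal modulo `N`.

The core is `flat_quotient_range`: if `0 → L → F → F' → F''` is exact with flat terms, then `F/L` is
flat. Multiplying by some `c ∈ m` with `c² ≠ 0` lets one argue as over a valuation ring. If some
annihilator of `c * r ≠ 0` is principal modulo the annihilator of `c`, purity at its generator
spreads to all multiples of `c`. If none is, factors from `m` can be split off annihilators, which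
makes the complex exact enough modulo `m`. Both cases give purity for ideals containing `N`, and `N²
= 0` extends it to all ideals.

Thus every finite flat resolution shrinks to length two. For `a ∈ m` with `a² ≠ 0`, a resolution of
`R/(a)` of that length would make the annihilator `A` of `a` flat. Being killed by `a`, it would
satisfy `A = A²`, and `A² ⊆ N² = 0`; but `A ≠ 0` since `a` is nilpotent. -/

/-- Any two elements are comparable for divisibility up to a square-zero error that is annihilated
by the divisor. -/
def IsQuasiChainRing (R : Type u) [CommRing R] : Prop :=
  ∀ a b : R, (∃ r d, b = a * r + d ∧ a * d = 0 ∧ d ^ 2 = 0) ∨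
    (∃ r d, a = b * r + d ∧ b * d = 0 ∧ d ^ 2 = 0)

/-! ### Local Gaussian rings are quasi-chain rings -/

section Gaussian

open Polynomial

variable {R : Type u} [CommRing R]

/-- The Gaussian hypothesis enters only here, through two linear polynomials. Later arguments choose
the factors so that the coefficients of the product collapse. -/
theorem IsGaussianRing.exists_mul_eq (h : IsGaussianRing R) (a b c d : R) {x y : R}
    (hx : x = a ∨ x = b) (hy : y = c ∨ y = d) :
    ∃ p q r, x * y = p * (a * c) + q * (a * d + b * c) + r * (b * d) := by
  have hcoeff : ∀ a b : R, ∀ x, x = a ∨ x = b → x ∈ (C a * X + C b : R[X]).contentIdeal := by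
    rintro a b x (rfl | rfl)
    · have := coeff_mem_contentIdeal (p := (C x * X + C b : R[X])) 1
      simpa only [coeff_add, coeff_C_mul, coeff_X_one, mul_one, coeff_C_succ, add_zero] using this
    · have := coeff_mem_contentIdeal (p := (C a * X + C x : R[X])) 0
      simpa only [coeff_add, coeff_C_mul, coeff_X_zero, mul_zero, coeff_C_zero, zero_add] using this
  have hmem := Ideal.mul_mem_mul (hcoeff a b x hx) (hcoeff c d y hy)
  rw [h _ _] at hmem
  have hprod : (C a * X + C b) * (C c * X + C d : R[X]) =
      C (a * c) * X ^ 2 + C (a * d + b * c) * X + C (b * d) := by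
    simp only [C_mul, C_add]; ring
  have hle : ((C a * X + C b) * (C c * X + C d : R[X])).contentIdeal ≤
      Ideal.span {a * c, a * d + b * c, b * d} := by
    rw [contentIdeal_def, Ideal.span_le, hprod]
    intro z hz
    obtain ⟨n, -, rfl⟩ := mem_coeffs_iff.1 hz
    simp only [coeff_add, coeff_C_mul, coeff_X_pow, coeff_X, coeff_C]
    refine Ideal.add_mem _ (Ideal.add_mem _ ?_ ?_) ?_
    · exact Ideal.mul_mem_right _ _ (Ideal.subset_span (by simp))
    · exact Ideal.mul_mem_right _ _ (Ideal.subset_span (by simp))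
    · split_ifs
      · exact Ideal.subset_span (by simp)
      · exact zero_mem _
  obtain ⟨p, q, r, hpqr⟩ := Submodule.mem_span_triple.1 (hle hmem)
  exact ⟨p, q, r, by simpa using hpqr.symm⟩

theorem IsGaussianRing.exists_mul_eq_sq_add_sq (h : IsGaussianRing R) (a b : R) :
    ∃ r s, a * b = r * a ^ 2 + s * b ^ 2 := by
  obtain ⟨p, q, r, e⟩ := h.exists_mul_eq a b a (-b) (Or.inl rfl : a = a ∨ a = b)
    (Or.inr rfl : -b = a ∨ -b = -b)
  exact ⟨-p, r, by linear_combination -e⟩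

/-- The case of a relation `a * b = r * a ^ 2 + s * b ^ 2` with nonunit coefficients. -/
theorem IsGaussianRing.sq_dvd_or_of_not_isUnit [IsLocalRing R] (h : IsGaussianRing R)
    {a b r s : R} (e : a * b = r * a ^ 2 + s * b ^ 2) (hs : ¬ IsUnit s)
    (hr : ¬ IsUnit r) : a ^ 2 ∣ b ^ 2 ∨ b ^ 2 ∣ a ^ 2 := by
  obtain ⟨p, q, p', e'⟩ := h.exists_mul_eq a b b a (Or.inr rfl : b = a ∨ b = b)
    (Or.inl rfl : b = b ∨ b = a)
  have key : (1 - (p + p') * s - q) * b ^ 2 = ((p + p') * r + q) * a ^ 2 := by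
    linear_combination e' + (p + p') * e
  by_cases hu : IsUnit ((p + p') * r + q)
  · exact Or.inr (hu.dvd_mul_left.1 ⟨_, by rw [← key, mul_comm]⟩)
  · have hq : ¬ IsUnit q := fun hq => hu (by
      by_contra hu
      have : q ∈ nonunits R := by
        have := IsLocalRing.nonunits_add (a := (p + p') * r + q) (b := -((p + p') * r)) hu
          (fun h' => hr (isUnit_of_mul_isUnit_right (IsUnit.neg_iff _ |>.1 h')))
        simpa using this
      exact this hq)
    have hu' : IsUnit (1 - (p + p') * s - q) := by
      have h1 := IsLocalRing.isUnit_or_isUnit_one_sub_self ((p + p') * s + q)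
      rcases h1 with h1 | h1
      · exact absurd h1 (IsLocalRing.nonunits_add
          (fun h' => hs (isUnit_of_mul_isUnit_right h')) hq)
      · rwa [← sub_sub] at h1
    exact Or.inl (hu'.dvd_mul_left.1 ⟨_, by rw [key, mul_comm]⟩)

theorem IsGaussianRing.sq_dvd_or_of_not_isUnit_right [IsLocalRing R] (h : IsGaussianRing R)
    {a b r s : R} (e : a * b = r * a ^ 2 + s * b ^ 2) (hs : ¬ IsUnit s) :
    a ^ 2 ∣ b ^ 2 ∨ b ^ 2 ∣ a ^ 2 := by
  -- Replacing `b` by `b - r * a` makes both coefficients multiples of the nonunit `s`.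
  obtain ⟨b', rfl⟩ : ∃ b', b = b' + r * a := ⟨b - r * a, by ring⟩
  have hu : IsUnit (1 - 2 * s * r) :=
    (IsLocalRing.isUnit_or_isUnit_one_sub_self (2 * s * r)).resolve_left
      (fun h' => hs (isUnit_of_mul_isUnit_right (isUnit_of_mul_isUnit_left h')))
  obtain ⟨v, hv⟩ := hu.exists_left_inv
  have e1 : a * b' = (v * s * r ^ 2) * a ^ 2 + (v * s) * b' ^ 2 := by
    linear_combination v * e - a * b' * hv
  have hvs : ¬ IsUnit (v * s) := fun h' => hs (isUnit_of_mul_isUnit_right h')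
  have key := h.sq_dvd_or_of_not_isUnit e1 hvs (fun h' => hvs (isUnit_of_mul_isUnit_left h'))
  have key1 : a ^ 2 ∣ b' ^ 2 → a ^ 2 ∣ (b' + r * a) ^ 2 := by
    rintro ⟨t, ht⟩
    exact ⟨t + 2 * r * (v * s * r ^ 2 + v * s * t) + r ^ 2, by
      linear_combination (1 + 2 * r * v * s) * ht + 2 * r * e1⟩
  rcases key with key | ⟨t, ht⟩
  · exact Or.inl (key1 key)
  · by_cases htu : IsUnit t
    · exact Or.inl (key1 (htu.dvd_mul_right.1 (ht ▸ dvd_rfl)))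
    · have hw : IsUnit (1 + (2 * r * (v * s * r ^ 2 * t + v * s) + r ^ 2 * t)) := by
        have := (IsLocalRing.isUnit_or_isUnit_one_sub_self
          (-(2 * r * (v * s * r ^ 2 * t + v * s) + r ^ 2 * t))).resolve_left ?_
        · rwa [sub_neg_eq_add] at this
        · rw [IsUnit.neg_iff]
          refine IsLocalRing.nonunits_add (fun h' => ?_) (fun h' => htu (isUnit_of_mul_isUnit_right h'))
          exact IsLocalRing.nonunits_add (a := v * s * r ^ 2 * t) (b := v * s)
            (fun h'' => htu (isUnit_of_mul_isUnit_right h'')) hvs (isUnit_of_mul_isUnit_right h')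
      refine Or.inr (dvd_trans (hw.dvd_mul_right.1 (dvd_of_eq ?_)) ⟨t, ht⟩)
      linear_combination (2 * r * v * s * r ^ 2 + r ^ 2) * ht + 2 * r * e1

theorem IsGaussianRing.sq_dvd_or_sq_dvd [IsLocalRing R] (h : IsGaussianRing R) (a b : R) :
    a ^ 2 ∣ b ^ 2 ∨ b ^ 2 ∣ a ^ 2 := by
  obtain ⟨r, s, e⟩ := h.exists_mul_eq_sq_add_sq a b
  by_cases hs : IsUnit s
  · by_cases hr : IsUnit r
    · obtain ⟨w, hw⟩ := hs.exists_left_inv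
      -- The constant `w * r * a` makes the middle coefficient `w * (r * a ^ 2 + s * b ^ 2) = w * (a
      -- * b)`.
      obtain ⟨p, q, p', e'⟩ := h.exists_mul_eq a b b (w * r * a) (Or.inr rfl : b = a ∨ b = b)
        (Or.inl rfl : b = b ∨ b = w * r * a)
      have hwu : IsUnit w := IsUnit.of_mul_eq_one s hw
      have key : (1 - ((p + p' * w * r) * s + q)) * b ^ 2 =
          (((p + p' * w * r) * s + q) * (w * r)) * a ^ 2 := by
        linear_combination e' + (p + p' * w * r) * e - (p + p' * w * r) * r * a ^ 2 * hw
      rcases IsLocalRing.isUnit_or_isUnit_one_sub_self ((p + p' * w * r) * s + q) with hu | hu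
      · exact Or.inr ((hu.mul (hwu.mul hr)).dvd_mul_left.1 ⟨_, by rw [← key, mul_comm]⟩)
      · exact Or.inl (hu.dvd_mul_left.1 ⟨_, by rw [key, mul_comm]⟩)
    · exact (h.sq_dvd_or_of_not_isUnit_right (a := b) (b := a) (r := s) (s := r)
        (by linear_combination e) hr).symm
  · exact h.sq_dvd_or_of_not_isUnit_right e hs

theorem IsGaussianRing.isQuasiChainRing [IsLocalRing R] (h : IsGaussianRing R) :
    IsQuasiChainRing R := by
  have key : ∀ a b : R, a ^ 2 ∣ b ^ 2 → ∃ r d, b = a * r + d ∧ a * d = 0 ∧ d ^ 2 = 0 := by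
    rintro a b ⟨t, ht⟩
    obtain ⟨r, s, e⟩ := h.exists_mul_eq_sq_add_sq a b
    obtain ⟨d, rfl⟩ : ∃ d, b = a * (r + s * t) + d := ⟨b - a * (r + s * t), by ring⟩
    have had : a * d = 0 := by linear_combination e + s * ht
    have hd : d ^ 2 = (t - (r + s * t) ^ 2) * a ^ 2 := by
      linear_combination ht - 2 * (r + s * t) * had
    -- By `had` and `hd` every coefficient of this product vanishes, while `d * d` is a product of
    -- coefficients of the factors.
    obtain ⟨p, q, p', e'⟩ := h.exists_mul_eq a d d (-((t - (r + s * t) ^ 2) * a))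
      (Or.inr rfl : d = a ∨ d = d) (Or.inl rfl : d = d ∨ d = -((t - (r + s * t) ^ 2) * a))
    exact ⟨_, d, rfl, had, by
      linear_combination e' + q * hd + (p - p' * (t - (r + s * t) ^ 2)) * had⟩
  intro a b
  exact (h.sq_dvd_or_sq_dvd a b).imp (key a b) (key b a)

end Gaussian

/-! ### Arithmetic of quasi-chain rings -/

section QuasiChain

variable {R : Type u} [CommRing R]

theorem IsQuasiChainRing.mul_eq_zero (h : IsQuasiChainRing R) {x y : R} (hx : x ^ 2 = 0)
    (hy : y ^ 2 = 0) : x * y = 0 := by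
  rcases h x y with ⟨r, d, e, hd, -⟩ | ⟨r, d, e, hd, -⟩
  · linear_combination x * e + r * hx + hd
  · linear_combination y * e + r * hy + hd

/-- The ideal of square-zero elements. -/
def IsQuasiChainRing.sqZero (h : IsQuasiChainRing R) : Ideal R where
  carrier := {x | x ^ 2 = 0}
  zero_mem' := by simp
  add_mem' := by
    intro x y hx hy
    have hxy := h.mul_eq_zero hx hy
    simp only [Set.mem_ofPred_eq] at *
    linear_combination hx + hy + 2 * hxy
  smul_mem' := by
    intro r x hx
    simp only [Set.mem_ofPred_eq, smul_eq_mul] at *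
    linear_combination r ^ 2 * hx

theorem IsQuasiChainRing.sqZero_mul_sqZero (h : IsQuasiChainRing R) :
    h.sqZero * h.sqZero = ⊥ := by
  rw [eq_bot_iff, Ideal.mul_le]
  exact fun x hx y hy => h.mul_eq_zero hx hy

theorem IsQuasiChainRing.sq_eq_zero_of_mul_eq_zero (h : IsQuasiChainRing R) {a b : R}
    (ha : a ^ 2 ≠ 0) (hab : a * b = 0) : b ^ 2 = 0 := by
  rcases h a b with ⟨r, d, rfl, had, hd⟩ | ⟨r, d, rfl, hbd, hd⟩
  · linear_combination r * hab + r * had + hd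
  · exact absurd (by linear_combination r * hab + r * hbd + hd) ha

variable [IsLocalRing R]

/-- Descending induction on the exponent, from `a ^ n = 0`. Subtracting a multiple reduces to two
elements with product zero: either one of them is killed by `a`, or both are multiples of `a` up to
errors killed by `a`, and the exponent rises. -/
theorem IsQuasiChainRing.dvd_or_dvd_of_pow (h : IsQuasiChainRing R) {a : R} (ha : a ^ 2 ≠ 0)
    {n : ℕ} (hn : a ^ n = 0) (k : ℕ) : ∀ x y : R,
      a ^ (n - k) * a * x ∣ a ^ (n - k) * a * y ∨ a ^ (n - k) * a * y ∣ a ^ (n - k) * a * x := by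
  induction k with
  | zero => intro x y; simp [hn]
  | succ k ih =>
    intro x y
    -- Once `k ≥ n`, truncated subtraction keeps the exponent at zero.
    by_cases hk : n ≤ k
    · have : n - (k + 1) = n - k := by omega
      rw [this]; exact ih x y
    obtain ⟨m, hm⟩ : ∃ m, n - (k + 1) = m := ⟨_, rfl⟩
    have hm' : n - k = m + 1 := by omega
    rw [hm'] at ih
    rw [hm]
    have orth : ∀ s f : R, s * f = 0 →
        a ^ m * a * s ∣ a ^ m * a * f ∨ a ^ m * a * f ∣ a ^ m * a * s := by
      have aux : ∀ s f t g : R, s * f = 0 → a = s * t + g → s * g = 0 → g ^ 2 = 0 →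
          a * f = 0 := by
        intro s f t g hsf e hsg hg
        have hs : s ^ 2 ≠ 0 := fun hs => ha (by
          linear_combination (a + s * t + g) * e + t ^ 2 * hs + 2 * t * hsg + hg)
        have := h.mul_eq_zero hg (h.sq_eq_zero_of_mul_eq_zero hs hsf)
        linear_combination f * e + t * hsf + this
      intro s f hsf
      rcases h a s with ⟨s', g, es, hag, -⟩ | ⟨t, g, e, hsg, hg⟩
      · rcases h a f with ⟨f', g', ef, hag', -⟩ | ⟨t, g', e, hfg, hg⟩
        · have h1 : a ^ m * a * s = a ^ (m + 1) * a * s' := by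
            linear_combination a ^ m * a * es + a ^ m * hag
          have h2 : a ^ m * a * f = a ^ (m + 1) * a * f' := by
            linear_combination a ^ m * a * ef + a ^ m * hag'
          rw [h1, h2]; exact ih s' f'
        · have : a ^ m * a * s = 0 := by
            linear_combination a ^ m * aux f s t g' (by rw [mul_comm, hsf]) e hfg hg
          exact Or.inr (this ▸ dvd_zero _)
      · have : a ^ m * a * f = 0 := by linear_combination a ^ m * aux s f t g hsf e hsg hg
        exact Or.inl (this ▸ dvd_zero _)
    have key : ∀ s f : R, (∃ r d, f = s * r + d ∧ s * d = 0 ∧ d ^ 2 = 0) →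
        a ^ m * a * s ∣ a ^ m * a * f ∨ a ^ m * a * f ∣ a ^ m * a * s := by
      rintro s _ ⟨r, d, rfl, hsd, -⟩
      rcases orth s d hsd with ⟨t, ht⟩ | ⟨t, ht⟩
      · exact Or.inl ⟨r + t, by linear_combination ht⟩
      · rcases IsLocalRing.isUnit_or_isUnit_one_sub_self (-(t * r)) with hu | hu
        · rw [IsUnit.neg_iff] at hu
          obtain ⟨v, hv⟩ := (isUnit_of_mul_isUnit_left hu).exists_right_inv
          exact Or.inl ⟨r + v, by linear_combination -v * ht - (a ^ m * a * d) * hv⟩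
        · obtain ⟨v, hv⟩ := hu.exists_right_inv
          exact Or.inr ⟨v * t, by
            linear_combination (1 - r * v * t) * ht - a ^ m * a * d * t * hv⟩
    rcases h x y with h' | h'
    · exact key x y h'
    · exact (key y x h').symm

theorem IsQuasiChainRing.dvd_or_dvd (h : IsQuasiChainRing R) {a : R} (ha : a ^ 2 ≠ 0)
    (hn : IsNilpotent a) (x y : R) : a * x ∣ a * y ∨ a * y ∣ a * x := by
  obtain ⟨n, hn⟩ := hn
  simpa using h.dvd_or_dvd_of_pow ha hn n x y

open IsLocalRing

/-- A local quasi-chain ring whose maximal ideal is nil, and is not principal modulo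
square-zero elements. -/
structure IsNilQuasiChainRing (R : Type u) [CommRing R] [IsLocalRing R] : Prop where
  isQuasiChainRing : IsQuasiChainRing R
  isNilpotent : ∀ x ∈ maximalIdeal R, IsNilpotent x
  exists_ne : ∀ a ∈ maximalIdeal R, ∃ e ∈ maximalIdeal R, ∀ r d : R, d ^ 2 = 0 → e ≠ a * r + d

theorem IsQuasiChainRing.isNilQuasiChainRing (h : IsQuasiChainRing R)
    (hnil : ∀ x ∈ maximalIdeal R, IsNilpotent x) (hnot : ¬ IsNilpotent (maximalIdeal R)) :
    IsNilQuasiChainRing R := by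
  refine ⟨h, hnil, fun a ha => ?_⟩
  by_contra! hcon
  have hle : maximalIdeal R ≤ Ideal.span {a} ⊔ h.sqZero := by
    intro e he
    obtain ⟨r, d, hd, rfl⟩ := hcon e he
    exact add_mem (Ideal.mem_sup_left (Ideal.mem_span_singleton'.2 ⟨r, mul_comm _ _⟩))
      (Ideal.mem_sup_right hd)
  obtain ⟨n, hn⟩ := hnil a ha
  have hpow : (Ideal.span {a} ⊔ h.sqZero) ^ n ≤ h.sqZero := by
    refine (Ideal.map_eq_bot_iff_le_ker (Ideal.Quotient.mk h.sqZero)).1 ?_ |>.trans_eq Ideal.mk_ker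
    rw [Ideal.map_pow, Ideal.map_sup, Ideal.map_quotient_self, sup_bot_eq, ← Ideal.map_pow,
      Ideal.span_singleton_pow, hn]
    simp
  refine hnot ⟨n * 2, ?_⟩
  have h1 : maximalIdeal R ^ n ≤ h.sqZero := by
    exact (Ideal.pow_right_mono hle n).trans hpow
  rw [pow_mul, sq, Ideal.zero_eq_bot, eq_bot_iff, ← h.sqZero_mul_sqZero]
  exact Ideal.mul_mono h1 h1

namespace IsNilQuasiChainRing

/-- Choosing `e` outside `(a) + N` forces `a` to be the multiple; a unit quotient would put `e` back
into `(a) + N`. -/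
theorem exists_eq_mul_add (h : IsNilQuasiChainRing R) {a : R} (ha : a ∈ maximalIdeal R) :
    ∃ e ∈ maximalIdeal R, e ^ 2 ≠ 0 ∧ ∃ r ∈ maximalIdeal R, ∃ d, a = e * r + d ∧ e * d = 0 ∧
      d ^ 2 = 0 := by
  obtain ⟨e, he, hne⟩ := h.exists_ne a ha
  refine ⟨e, he, fun he2 => hne 0 e he2 (by simp), ?_⟩
  rcases h.isQuasiChainRing e a with ⟨r, d, had, hed, hd⟩ | ⟨r, d, hed, -, hd⟩
  · refine ⟨r, fun hr => ?_, d, had, hed, hd⟩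
    obtain ⟨v, hv⟩ := hr.exists_right_inv
    exact hne v (-(v * d)) (by linear_combination v ^ 2 * hd)
      (by linear_combination -v * had - e * hv)
  · exact absurd hed (hne r d hd)

theorem exists_mul_eq_mul_mul (h : IsNilQuasiChainRing R) {c b : R}
    (hc : c ∈ maximalIdeal R) (hc2 : c ^ 2 ≠ 0) (hb : b ∈ maximalIdeal R) :
    ∃ e ∈ maximalIdeal R, ∃ u ∈ maximalIdeal R, c * b = c * e * u := by
  obtain ⟨e, he, hne⟩ := h.exists_ne b hb
  have hnot : ∀ w, c * e ≠ c * b * w := fun w hw =>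
    hne w (e - b * w) (h.isQuasiChainRing.sq_eq_zero_of_mul_eq_zero hc2
      (by linear_combination hw)) (by ring)
  rcases h.isQuasiChainRing.dvd_or_dvd hc2 (h.isNilpotent c hc) e b with ⟨u, hu⟩ | ⟨u, hu⟩
  · refine ⟨e, he, u, fun hu' => ?_, hu⟩
    obtain ⟨v, hv⟩ := hu'.exists_right_inv
    exact hnot v (by linear_combination -v * hu - c * e * hv)
  · exact absurd hu (hnot u)

/-- Each element has its own divisor; whichever divides the other serves both. The foreign error is
divided again by it, so that the new error is annihilated. -/
theorem exists_common (h : IsNilQuasiChainRing R) {a b : R}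
    (ha : a ∈ maximalIdeal R) (hb : b ∈ maximalIdeal R) :
    ∃ e ∈ maximalIdeal R, e ^ 2 ≠ 0 ∧ ∃ r s i j, a = e * r + i ∧ b = e * s + j ∧
      i ^ 2 = 0 ∧ j ^ 2 = 0 ∧ e * i = 0 ∧ e * j = 0 := by
  have aux : ∀ a b e f r s i j : R, f ∈ maximalIdeal R → e ^ 2 ≠ 0 →
      a = e * r + i → e * i = 0 → i ^ 2 = 0 → b = f * s + j → j ^ 2 = 0 →
      (∃ t d, f = e * t + d ∧ e * d = 0 ∧ d ^ 2 = 0) →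
      ∃ r s i j, a = e * r + i ∧ b = e * s + j ∧
        i ^ 2 = 0 ∧ j ^ 2 = 0 ∧ e * i = 0 ∧ e * j = 0 := by
    rintro a b e f r s i j hf he ha hei hi hb hj ⟨t, d, hf', hed, hd⟩
    have hjd := h.isQuasiChainRing.mul_eq_zero hj hd
    rcases h.isQuasiChainRing e j with ⟨q, j', hj', hej', hj'2⟩ | ⟨q, j', hj', hej', hj'2⟩
    · refine ⟨r, t * s + q, i, d * s + j', ha, by linear_combination hb + s * hf' + hj', hi, ?_,
        hei, by linear_combination s * hed + hej'⟩
      have := h.isQuasiChainRing.mul_eq_zero hd hj'2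
      linear_combination s ^ 2 * hd + 2 * s * this + hj'2
    · refine absurd ?_ he
      linear_combination (e + j * q + j') * hj' + q ^ 2 * hj + 2 * q * hej' + hj'2
  obtain ⟨e, he, he2, r, -, i, ha', hei, hi⟩ := h.exists_eq_mul_add ha
  obtain ⟨f, hf, hf2, s, -, j, hb', hfj, hj⟩ := h.exists_eq_mul_add hb
  rcases h.isQuasiChainRing e f with hef | hfe
  · exact ⟨e, he, he2, aux a b e f r s i j hf he2 ha' hei hi hb' hj hef⟩
  · obtain ⟨s, r, j, i, h1, h2, h3, h4, h5, h6⟩ :=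
      aux b a f e s r j i he hf2 hb' hfj hj ha' hi hfe
    exact ⟨f, hf, hf2, r, s, i, j, h2, h1, h4, h3, h6, h5⟩

/-- The errors cancel in the product, leaving a multiple of `e²`. Splitting `e` into two factors in
`m` with a common divisor `c` makes `e²` a multiple of `c⁴`. -/
theorem exists_cube_dvd_mul (h : IsNilQuasiChainRing R) {a b : R}
    (ha : a ∈ maximalIdeal R) (hb : b ∈ maximalIdeal R) :
    ∃ c ∈ maximalIdeal R, c ^ 2 ≠ 0 ∧ c ^ 3 ∣ a * b := by
  obtain ⟨e, he, -, r, s, i, j, rfl, rfl, hi, hj, hei, hej⟩ := h.exists_common ha hb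
  have hij := h.isQuasiChainRing.mul_eq_zero hi hj
  obtain ⟨e', he', -, r', hr', d, rfl, hed, hd⟩ := h.exists_eq_mul_add he
  obtain ⟨c, hc, hc2, u, v, k, l, rfl, rfl, hk, hl, hck, hcl⟩ := h.exists_common he' hr'
  refine ⟨c, hc, hc2, c * u ^ 2 * v ^ 2 * r * s, ?_⟩
  have e1 : ((c * u + k) * (c * v + l) + d) ^ 2 = c ^ 4 * u ^ 2 * v ^ 2 := by
    have e2 : (c * u + k) ^ 2 = c ^ 2 * u ^ 2 := by linear_combination 2 * u * hck + hk
    have e3 : (c * v + l) ^ 2 = c ^ 2 * v ^ 2 := by linear_combination 2 * v * hcl + hl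
    linear_combination (c * v + l) ^ 2 * e2 + c ^ 2 * u ^ 2 * e3 + 2 * (c * v + l) * hed + hd
  linear_combination r * s * e1 + s * hei + r * hej + hij

theorem _root_.IsQuasiChainRing.cube_dvd_or_cube_dvd {R : Type u} [CommRing R]
    (h : IsQuasiChainRing R) (a b : R) : a ^ 3 ∣ b ^ 3 ∨ b ^ 3 ∣ a ^ 3 := by
  have key : ∀ a b : R, (∃ r d, b = a * r + d ∧ a * d = 0 ∧ d ^ 2 = 0) → a ^ 3 ∣ b ^ 3 := by
    rintro a _ ⟨r, d, rfl, had, hd⟩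
    exact ⟨r ^ 3, by linear_combination (3 * a * r ^ 2 + 3 * r * d) * had + d * hd⟩
  exact (h a b).imp (key a b) (key b a)

theorem exists_mul_eq_zero_and_ne (h : IsNilQuasiChainRing R) {b : R} (hb : b ∈ maximalIdeal R)
    {x : R} (hxb : x * b ≠ 0) : ∃ y, x * b * y = 0 ∧ x * y ≠ 0 := by
  classical
  obtain ⟨n, hn⟩ := h.isNilpotent b hb
  have hex : ∃ n, x * b ^ n = 0 := ⟨n, by rw [hn, mul_zero]⟩
  obtain ⟨k, hk⟩ : ∃ k, Nat.find hex = k + 1 := Nat.exists_eq_succ_of_ne_zero (fun h0 => hxb (by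
    have := Nat.find_spec hex
    rw [h0, pow_zero, mul_one] at this
    rw [this, zero_mul]))
  -- `b ^ k` is the last power of `b` not killing `x`.
  refine ⟨b ^ k, ?_, Nat.find_min hex (by omega)⟩
  have := Nat.find_spec hex
  rw [hk, pow_succ'] at this
  rw [mul_assoc, this]

end IsNilQuasiChainRing
end QuasiChain

/-! ### Annihilators and divisibility in flat modules -/

section FlatModules

variable {R : Type u} [CommRing R]

/-- Colon ideals commute with flat modules: the equational criterion is applied to the relation
expressing `d • f` through elements of `I`. -/
theorem Module.Flat.mem_smul_top_of_smul_mem {F : Type v} [AddCommGroup F] [Module R F]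
    [Module.Flat R F] {I K : Ideal R} {d : R} (hK : ∀ z, d * z ∈ I → z ∈ K) {f : F}
    (hf : d • f ∈ I • (⊤ : Submodule R F)) : f ∈ K • (⊤ : Submodule R F) := by
  have htop : (⊤ : Submodule R F) = Submodule.span R (Set.range (id : F → F)) := by simp
  rw [htop, Submodule.mem_ideal_smul_span_iff_exists_sum] at hf
  obtain ⟨a, ha, hsum⟩ := hf
  let coef : Option a.support → R := fun o => o.elim d (fun i => -a i)
  let vec : Option a.support → F := fun o => o.elim f (fun i => i)
  have hrel : ∑ o, coef o • vec o = 0 := by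
    rw [Fintype.sum_option]
    simp only [coef, vec, Option.elim, neg_smul, Finset.sum_neg_distrib]
    rw [← hsum, Finsupp.sum, ← Finset.sum_coe_sort a.support (fun i => a i • id i)]
    simp
  obtain ⟨k, α, y, hy, hα⟩ := Module.Flat.isTrivialRelation_of_sum_smul_eq_zero hrel
  have hf' : f = ∑ j, α none j • y j := hy none
  rw [hf']
  refine Submodule.sum_mem _ fun j _ => Submodule.smul_mem_smul (hK _ ?_) trivial
  have := hα j
  rw [Fintype.sum_option] at this
  simp only [coef, Option.elim, neg_mul, Finset.sum_neg_distrib] at this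
  rw [add_neg_eq_zero.1 this]
  exact Ideal.sum_mem _ fun i _ => Ideal.mul_mem_right _ _ (ha i)

theorem Module.Flat.mem_smul_top_of_smul_eq_zero {F : Type v} [AddCommGroup F] [Module R F]
    [Module.Flat R F] {K : Ideal R} {d : R} (hK : ∀ z, d * z = 0 → z ∈ K) {f : F}
    (hf : d • f = 0) : f ∈ K • (⊤ : Submodule R F) :=
  Module.Flat.mem_smul_top_of_smul_mem (I := ⊥) (fun z hz => hK z (by simpa using hz))
    (by rw [hf]; exact zero_mem _)

/-- If the principal ideal `(c)` is uniserial, an element of `K • F` is, up to multiplication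
by `c`, a multiple of an element of `K`. -/
theorem exists_smul_eq_of_mem_smul_top {F : Type v} [AddCommGroup F] [Module R F] {c : R}
    (hc : ∀ x y, c * x ∣ c * y ∨ c * y ∣ c * x) {K : Ideal R} {f : F}
    (hf : f ∈ K • (⊤ : Submodule R F)) : ∃ a ∈ K, ∃ f' : F, c • f = (c * a) • f' := by
  refine Submodule.smul_induction_on hf (fun a ha f _ => ⟨a, ha, f, smul_smul _ _ _⟩) ?_
  rintro f g ⟨a, ha, f', hf'⟩ ⟨b, hb, g', hg'⟩
  rcases hc a b with ⟨t, ht⟩ | ⟨t, ht⟩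
  · exact ⟨a, ha, f' + t • g', by rw [smul_add, hf', hg', ht, smul_add, mul_smul _ t]⟩
  · exact ⟨b, hb, t • f' + g', by rw [smul_add, hf', hg', ht, smul_add, mul_smul _ t]⟩

theorem Module.Flat.exists_smul_eq_of_smul_eq_zero {F : Type v} [AddCommGroup F] [Module R F]
    [Module.Flat R F] {c : R} (hc : ∀ x y, c * x ∣ c * y ∨ c * y ∣ c * x) {u b : R}
    (hb : ∀ z, u * z = 0 → c * b ∣ c * z) {f : F} (hf : u • f = 0) :
    ∃ f' : F, c • f = (c * b) • f' := by
  obtain ⟨a, ha, f', hf'⟩ := exists_smul_eq_of_mem_smul_top hc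
    (Module.Flat.mem_smul_top_of_smul_eq_zero (K := LinearMap.ker (LinearMap.mulLeft R u))
      (fun z hz => by simpa using hz) hf)
  obtain ⟨t, ht⟩ := hb a (by simpa using ha)
  exact ⟨t • f', by rw [hf', ht, mul_smul _ t]⟩

theorem Module.Flat.exists_smul_eq_of_mul_smul_eq_zero {F : Type v} [AddCommGroup F] [Module R F]
    [Module.Flat R F] {c : R} (hc : ∀ x y, c * x ∣ c * y ∨ c * y ∣ c * x) {y b : R}
    (hb : c * y * b ≠ 0) {f : F} (hf : (c * y) • f = 0) : ∃ f' : F, c • f = (c * b) • f' := by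
  refine exists_smul_eq_of_smul_eq_zero hc (fun z hz => ?_) hf
  refine (hc b z).resolve_right ?_
  rintro ⟨t, ht⟩
  exact hb (by linear_combination y * ht + t * hz)

end FlatModules

/-! ### Purity at multiples of one element -/

/-- The map `ι : L → F` is pure with respect to division of multiples of `c` by `v`. -/
def IsPureAt {R : Type u} [CommRing R] {L F : Type v} [AddCommGroup L] [Module R L]
    [AddCommGroup F] [Module R F] (ι : L →ₗ[R] F) (c v : R) : Prop :=
  ∀ l f, c • ι l = v • f → ∃ l', c • l = v • l'

section Purity

variable {R : Type u} [CommRing R] {L F : Type v} [AddCommGroup L] [Module R L]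
  [AddCommGroup F] [Module R F] {ι : L →ₗ[R] F} {c : R}

open IsLocalRing

theorem IsPureAt.of_mul [Module.Flat R L] (hc : ∀ x y, c * x ∣ c * y ∨ c * y ∣ c * x) {a b : R} (hab : c * (a * b) ≠ 0)
    (hp : IsPureAt ι c (c * (a * b))) : IsPureAt ι c (c * a) := by
  intro l f hlf
  obtain ⟨l', hl'⟩ := hp (b • l) f (by
    rw [map_smul, smul_comm, hlf, smul_smul]; congr 1; ring)
  obtain ⟨l'', hl''⟩ := Module.Flat.exists_smul_eq_of_mul_smul_eq_zero hc (y := b) (b := a)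
    (f := l - a • l') (by convert hab using 1; ring) (by
      rw [smul_sub, mul_smul, hl', smul_smul, sub_eq_zero]; congr 1; ring)
  refine ⟨l' + l'', ?_⟩
  rw [smul_add, ← hl'', smul_sub, smul_smul]; abel

theorem IsPureAt.mul [Module.Flat R F] (hc : ∀ x y, c * x ∣ c * y ∨ c * y ∣ c * x)
    {s b : R} (hsb : c * (s * b) ≠ 0)
    (hs : IsPureAt ι c (c * s)) (hb : IsPureAt ι c (c * b)) : IsPureAt ι c (c * (s * b)) := by
  intro l f hlf
  obtain ⟨l', hl'⟩ := hs l (b • f) (by rw [hlf, smul_smul, mul_assoc])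
  have h0 : (c * s) • (ι l' - b • f) = 0 := by
    rw [smul_sub, ← map_smul, ← hl', map_smul, hlf, smul_smul, mul_assoc, sub_self]
  obtain ⟨f', hf'⟩ := Module.Flat.exists_smul_eq_of_mul_smul_eq_zero hc (y := s) (b := b)
    (by rwa [mul_assoc]) h0
  obtain ⟨l'', hl''⟩ := hb l' (f + f') (by
    rw [smul_add, ← hf', smul_sub, smul_smul]; abel)
  exact ⟨l'', by rw [hl', mul_comm, mul_smul, hl'', smul_smul]; congr 1; ring⟩

theorem IsPureAt.of_annihilator [Module.Flat R L]
    (hc : ∀ x y, c * x ∣ c * y ∨ c * y ∣ c * x)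
    (hι : Function.Injective ι) {r s : R} (hrs : c * r * s = 0)
    (hmin : ∀ z, c * r * z = 0 → c * s ∣ c * z) : IsPureAt ι c (c * s) := by
  intro l f hlf
  refine Module.Flat.exists_smul_eq_of_smul_eq_zero hc hmin (hι ?_)
  rw [map_smul, mul_comm, mul_smul, hlf, smul_smul, map_zero,
    show r * (c * s) = 0 by linear_combination hrs, zero_smul]

/-- Compare `a` with `s`: either `c * a` divides `c * s` and `of_mul` applies, or `s` splits off and
the remaining factor is handled by induction and `mul`. -/
theorem IsPureAt.of_dvd_pow [Module.Flat R L] [Module.Flat R F]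
    (hc : ∀ x y, c * x ∣ c * y ∨ c * y ∣ c * x)
    {s : R} (hs0 : c * s ≠ 0) (hs : IsPureAt ι c (c * s)) (k : ℕ) :
    ∀ a, c * a ≠ 0 → c * a ∣ c * s ^ k → IsPureAt ι c (c * a) := by
  induction k with
  | zero =>
    rintro a - ⟨z, hz⟩ l f hlf
    exact ⟨z • l, by rw [smul_smul, ← hz, pow_zero, mul_one]⟩
  | succ k ih =>
    rintro a ha ⟨z, hz⟩
    rcases hc a s with ⟨t, ht⟩ | ⟨b, hb⟩
    · rw [mul_assoc] at ht
      exact IsPureAt.of_mul hc (ht ▸ hs0) (ht ▸ hs)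
    · rw [mul_assoc] at hb
      have hsb : c * (s * b) ≠ 0 := hb ▸ ha
      rw [hb]
      refine IsPureAt.mul hc hsb hs (ih b (fun h0 => hsb (by linear_combination s * h0)) ?_)
      have hw : c * s * (s ^ k - b * z) = 0 := by linear_combination hz + z * hb
      rcases hc b (s ^ k - b * z) with ⟨t, ht⟩ | ⟨t, ht⟩
      · exact ⟨z + t, by linear_combination ht⟩
      · exact absurd (by linear_combination s * ht + t * hw) hsb

/-- If the annihilator of a nonzero multiple `c * r` is principal modulo the annihilator of `c`,
then `ι` is pure at all multiples of `c`. -/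
theorem isPureAt_of_principal_annihilator [Module.Flat R L] [Module.Flat R F]
    (hc : ∀ x y, c * x ∣ c * y ∨ c * y ∣ c * x)
    (hι : Function.Injective ι) {r s : R} (hrs : c * r * s = 0) (hs0 : c * s ≠ 0)
    (hs : IsNilpotent s) (hmin : ∀ z, c * r * z = 0 → c * s ∣ c * z) (a : R) :
    IsPureAt ι c (c * a) := by
  by_cases ha : c * a = 0
  · intro l f hlf
    refine ⟨0, hι ?_⟩
    rw [map_smul, hlf, ha]; simp
  · obtain ⟨k, hk⟩ := hs
    exact IsPureAt.of_dvd_pow hc hs0 (IsPureAt.of_annihilator hc hι hrs hmin) k a ha (by simp [hk])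

/-- Elements of `L` that are divisible in `F` by a product `c * a * b` with `b` a nonunit are
divisible by `c * a` in `L`. -/
theorem IsNilQuasiChainRing.exists_smul_eq [IsLocalRing R] [Module.Flat R L]
    (h : IsNilQuasiChainRing R)
    (hι : Function.Injective ι) (hc : ∀ x y, c * x ∣ c * y ∨ c * y ∣ c * x) {a b : R}
    (hb : b ∈ maximalIdeal R) {l : L} {f : F} (hlf : c • ι l = (c * a * b) • f) :
    ∃ l', c • l = (c * a) • l' := by
  by_cases h0 : c * a * b = 0
  · exact ⟨0, hι (by rw [map_smul, hlf, h0]; simp)⟩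
  obtain ⟨y, hy, hy'⟩ := h.exists_mul_eq_zero_and_ne hb h0
  refine Module.Flat.exists_smul_eq_of_mul_smul_eq_zero hc (y := y) (b := a)
    (fun h' => hy' (by linear_combination h')) (hι ?_)
  rw [map_smul, mul_comm, mul_smul, hlf, smul_smul,
    show y * (c * a * b) = 0 by linear_combination hy, zero_smul, map_zero]

/-- Purity of `ι : L → F` with respect to the maximal ideal. -/
theorem IsNilQuasiChainRing.mem_maximalIdeal_smul_top [IsLocalRing R]
    [Module.Flat R L] (h : IsNilQuasiChainRing R)
    (hι : Function.Injective ι) {l : L} (hl : ι l ∈ maximalIdeal R • (⊤ : Submodule R F)) :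
    l ∈ maximalIdeal R • (⊤ : Submodule R L) := by
  obtain ⟨c, hc, hne⟩ := h.exists_ne 0 (zero_mem _)
  have hc2 : c ^ 2 ≠ 0 := fun h0 => hne 0 c h0 (by simp)
  have huni := h.isQuasiChainRing.dvd_or_dvd hc2 (h.isNilpotent c hc)
  obtain ⟨b, hb, f, hf⟩ := exists_smul_eq_of_mem_smul_top huni hl
  obtain ⟨e, he, u, hu, hbu⟩ := h.exists_mul_eq_mul_mul hc hc2 hb
  rw [hbu] at hf
  obtain ⟨l', hl'⟩ := h.exists_smul_eq hι huni hu hf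
  have hann : l - e • l' ∈ maximalIdeal R • (⊤ : Submodule R L) := by
    refine Module.Flat.mem_smul_top_of_smul_eq_zero (d := c) (fun z hz => ?_) ?_
    · refine fun hu : IsUnit z => hc2 ?_
      rw [hu.mul_left_eq_zero.1 hz]; simp
    · rw [smul_sub, hl', smul_smul, sub_self]
  rw [← sub_add_cancel l (e • l')]
  exact add_mem hann (Submodule.smul_mem_smul he trivial)

end Purity

/-! ### Exactness modulo the maximal ideal -/

section Exactness

open IsLocalRing

variable {R : Type u} [CommRing R] [IsLocalRing R]

theorem IsNilQuasiChainRing.exists_mem_maximalIdeal (h : IsNilQuasiChainRing R) :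
    ∃ c ∈ maximalIdeal R, c ^ 2 ≠ 0 := by
  obtain ⟨c, hc, hne⟩ := h.exists_ne 0 (zero_mem _)
  exact ⟨c, hc, fun h0 => hne 0 c h0 (by simp)⟩

theorem IsNilQuasiChainRing.exists_cube_dvd (h : IsNilQuasiChainRing R) {x : R}
    (hx : x ∈ maximalIdeal R * maximalIdeal R) : ∃ c ∈ maximalIdeal R, c ^ 2 ≠ 0 ∧ c ^ 3 ∣ x := by
  refine Submodule.mul_induction_on hx (fun a ha b hb => h.exists_cube_dvd_mul ha hb) ?_
  rintro x y ⟨c, hc, hc2, hcx⟩ ⟨d, hd, hd2, hdy⟩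
  rcases h.isQuasiChainRing.cube_dvd_or_cube_dvd c d with hcd | hdc
  · exact ⟨c, hc, hc2, dvd_add hcx (hcd.trans hdy)⟩
  · exact ⟨d, hd, hd2, dvd_add (hdc.trans hcx) hdy⟩

theorem IsNilQuasiChainRing.exists_eq_cube_smul (h : IsNilQuasiChainRing R) {F : Type v}
    [AddCommGroup F] [Module R F] {g : F}
    (hg : g ∈ (maximalIdeal R * maximalIdeal R) • (⊤ : Submodule R F)) :
    ∃ c ∈ maximalIdeal R, c ^ 2 ≠ 0 ∧ ∃ g' : F, g = c ^ 3 • g' := by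
  refine Submodule.smul_induction_on hg (fun a ha f _ => ?_) ?_
  · obtain ⟨c, hc, hc2, t, rfl⟩ := h.exists_cube_dvd ha
    exact ⟨c, hc, hc2, t • f, mul_smul _ _ _⟩
  · rintro _ _ ⟨c, hc, hc2, x, rfl⟩ ⟨d, hd, hd2, y, rfl⟩
    rcases h.isQuasiChainRing.cube_dvd_or_cube_dvd c d with ⟨t, ht⟩ | ⟨t, ht⟩
    · exact ⟨c, hc, hc2, x + t • y, by rw [ht, smul_add, mul_smul]⟩
    · exact ⟨d, hd, hd2, t • x + y, by rw [ht, smul_add, mul_smul]⟩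

/-- No annihilator of a nonzero multiple `c * r` is principal modulo the annihilator of `c`. -/
def HasNonprincipalAnnihilators (R : Type u) [CommRing R] [IsLocalRing R] : Prop :=
  ∀ c ∈ maximalIdeal R, c ^ 2 ≠ 0 → ∀ r s, c * r ≠ 0 → c * r * s = 0 →
    ∃ s', c * r * s' = 0 ∧ ∃ u ∈ maximalIdeal R, c * s = c * s' * u

theorem IsNilQuasiChainRing.exists_principal_annihilator (h : IsNilQuasiChainRing R)
    (hnp : ¬ HasNonprincipalAnnihilators R) :
    ∃ c ∈ maximalIdeal R, c ^ 2 ≠ 0 ∧ ∃ r s, c * r * s = 0 ∧ c * s ≠ 0 ∧ s ∈ maximalIdeal R ∧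
      ∀ z, c * r * z = 0 → c * s ∣ c * z := by
  simp only [HasNonprincipalAnnihilators] at hnp
  push Not at hnp
  obtain ⟨c, hc, hc2, r, s, hr, hrs, hall⟩ := hnp
  refine ⟨c, hc, hc2, r, s, hrs, fun h0 => hall 0 (by simp) 0 (zero_mem _) (by simp [h0]),
    fun hs : IsUnit s => hr (hs.mul_left_eq_zero.1 hrs), fun z hz => ?_⟩
  rcases h.isQuasiChainRing.dvd_or_dvd hc2 (h.isNilpotent c hc) s z with hd | ⟨t, ht⟩
  · exact hd
  · by_cases htu : IsUnit t
    · exact htu.dvd_mul_right.1 (dvd_of_eq ht)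
    · exact absurd ht (hall z hz t htu)

/-- For `x ∈ m`, `Q` corresponds to a hyperplane of the vector space `m/m²` complementary to `x`. -/
theorem IsLocalRing.exists_ideal_not_mem {x : R} (hx : x ∉ maximalIdeal R * maximalIdeal R) :
    ∃ Q : Ideal R, maximalIdeal R * maximalIdeal R ≤ Q ∧ x ∉ Q ∧
      maximalIdeal R ≤ Ideal.span {x} ⊔ Q := by
  obtain ⟨Q, hQ, hmax⟩ := zorn_le_nonempty₀ {Q : Ideal R | x ∉ Q} (fun C hC hchain I hI =>
    ⟨sSup C, fun hx' => by
      obtain ⟨J, hJ, hxJ⟩ := (Submodule.mem_sSup_of_directed ⟨I, hI⟩ hchain.directedOn).1 hx'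
      exact hC hJ hxJ, fun J hJ => le_sSup hJ⟩) _ hx
  refine ⟨Q, hQ, hmax.prop, fun y hy => ?_⟩
  by_contra hyQ
  have hx' : x ∈ Ideal.span {y} ⊔ Q := by
    by_contra hx'
    exact hyQ (Ideal.mem_sup_right (hmax.le_of_ge hx' le_sup_right
      (Ideal.mem_sup_left (Ideal.mem_span_singleton_self y))))
  obtain ⟨r, q, hq, hrq⟩ := Ideal.mem_span_singleton_sup.1 hx'
  by_cases hr : IsUnit r
  · obtain ⟨v, hv⟩ := hr.exists_right_inv
    exact hyQ (Ideal.mem_span_singleton_sup.2 ⟨v, -(v * q), Q.neg_mem (Q.mul_mem_left _ hq), by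
      linear_combination -v * hrq + y * hv⟩)
  · exact hmax.prop (hrq ▸ Q.add_mem (hQ (Ideal.mul_mem_mul hr hy)) hq)

variable {L F F' F'' : Type v} [AddCommGroup L] [AddCommGroup F] [AddCommGroup F']
  [AddCommGroup F''] [Module R L] [Module R F] [Module R F'] [Module R F'']
  {ι : L →ₗ[R] F} {d : F →ₗ[R] F'} {d' : F' →ₗ[R] F''}

/-- Write the element as `c³ g`. It suffices to factor `c³ = w * s` with `w ∈ m²` and `s • g` still
a cycle: lift `s • g`, then multiply by `w`. Nonprincipality, used twice on `c²` as an annihilator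
of `c * r`, splits off the two factors of `w`. -/
theorem IsNilQuasiChainRing.exists_map_eq [Module.Flat R F''] (h : IsNilQuasiChainRing R)
    (hnp : HasNonprincipalAnnihilators R) (hd : Function.Exact d d') {g : F'}
    (hg : g ∈ (maximalIdeal R * maximalIdeal R) • (⊤ : Submodule R F')) (hdg : d' g = 0) :
    ∃ f ∈ (maximalIdeal R * maximalIdeal R) • (⊤ : Submodule R F), d f = g := by
  obtain ⟨c, hc, hc2, g, rfl⟩ := h.exists_eq_cube_smul hg
  have huni := h.isQuasiChainRing.dvd_or_dvd hc2 (h.isNilpotent c hc)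
  rw [map_smul] at hdg
  obtain ⟨r, hr, k, hk⟩ := exists_smul_eq_of_mem_smul_top huni
    (Module.Flat.mem_smul_top_of_smul_eq_zero (K := LinearMap.ker (LinearMap.mulLeft R (c ^ 3)))
      (fun z hz => by simpa using hz) hdg)
  have hr : c ^ 3 * r = 0 := by simpa using hr
  suffices ∃ s, ∃ w ∈ maximalIdeal R * maximalIdeal R, c ^ 3 = w * s ∧ s • d' g = 0 by
    obtain ⟨s, w, hw, hws, hs⟩ := this
    obtain ⟨f, hf⟩ := (hd (s • g)).1 (by rw [map_smul, hs])
    exact ⟨w • f, Submodule.smul_mem_smul hw trivial, by rw [map_smul, hf, smul_smul, hws]⟩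
  by_cases hcr : c * r = 0
  · exact ⟨c, c * c, Ideal.mul_mem_mul hc hc, by ring, by rw [hk, hcr, zero_smul]⟩
  · obtain ⟨s₁, hs₁, u, hu, e₁⟩ := hnp c hc hc2 r (c ^ 2) hcr (by linear_combination hr)
    obtain ⟨s₂, hs₂, v, hv, e₂⟩ := hnp c hc hc2 r s₁ hcr hs₁
    refine ⟨s₂ * c, v * u, Ideal.mul_mem_mul hv hu, by linear_combination e₁ + u * e₂, ?_⟩
    rw [mul_smul, hk, smul_smul, show s₂ * (c * r) = 0 by linear_combination hs₂, zero_smul]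

theorem IsNilQuasiChainRing.exists_sub_mem [Module.Flat R L] [Module.Flat R F]
    [Module.Flat R F''] (h : IsNilQuasiChainRing R)
    (hnp : HasNonprincipalAnnihilators R) (hι : Function.Injective ι)
    (hιd : Function.Exact ι d) (hd : Function.Exact d d') {f : F}
    (hf : d f ∈ maximalIdeal R • (⊤ : Submodule R F')) :
    ∃ l, f - ι l ∈ maximalIdeal R • (⊤ : Submodule R F) := by
  by_cases hm : maximalIdeal R ≤ maximalIdeal R * maximalIdeal R
  · obtain ⟨f₂, hf₂, e⟩ := h.exists_map_eq hnp hd (Submodule.smul_mono_left hm hf)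
      (hd.apply_apply_eq_zero f)
    obtain ⟨l, hl⟩ := (hιd (f - f₂)).1 (by rw [map_sub, e, sub_self])
    refine ⟨l, ?_⟩
    rw [hl, sub_sub_cancel]
    exact Submodule.smul_mono_left Ideal.mul_le_left hf₂
  -- When `m ≠ m²`, multiplying by `x ∈ m \ m²` brings `d f` into `m² F'`. Flatness then removes
  -- `x`, since `x * z ∈ Q` forces `z ∈ m`.
  · obtain ⟨x, hx, hx2⟩ := SetLike.not_le_iff_exists.1 hm
    obtain ⟨Q, hQ, hxQ, hle⟩ := IsLocalRing.exists_ideal_not_mem hx2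
    obtain ⟨f₂, hf₂, e⟩ := h.exists_map_eq hnp hd (g := d (x • f))
      (by rw [map_smul, Submodule.mul_smul]; exact Submodule.smul_mem_smul hx hf)
      (hd.apply_apply_eq_zero _)
    obtain ⟨l₀, hl₀⟩ := (hιd (x • f - f₂)).1 (by rw [map_sub, e, sub_self])
    have hl₀m : l₀ ∈ maximalIdeal R • (⊤ : Submodule R L) := by
      refine h.mem_maximalIdeal_smul_top hι ?_
      rw [hl₀]
      exact sub_mem (Submodule.smul_mem_smul hx trivial)
        (Submodule.smul_mono_left Ideal.mul_le_left hf₂)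
    have := Submodule.smul_mono_left hle hl₀m
    rw [Submodule.sup_smul] at this
    obtain ⟨l₁, hl₁, q, hq, hlq⟩ := Submodule.mem_sup.1 this
    rw [Submodule.ideal_span_singleton_smul] at hl₁
    obtain ⟨l, -, rfl⟩ := (Submodule.mem_smul_pointwise_iff_exists _ _ _).1 hl₁
    have hιl₀ : ι l₀ = x • ι l + ι q := by rw [← hlq, map_add, map_smul]
    refine ⟨l, Module.Flat.mem_smul_top_of_smul_mem (I := Q) (d := x)
      (K := maximalIdeal R) (fun z hz hu => ?_) ?_⟩
    · exact hxQ ((Ideal.mul_unit_mem_iff_mem Q hu).1 hz)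
    · have e1 : x • (f - ι l) = f₂ + ι q := by
        linear_combination (norm := module) hιl₀ - hl₀
      rw [e1]
      refine add_mem (Submodule.smul_mono_left hQ hf₂) ?_
      have := Submodule.mem_map_of_mem (f := ι) hq
      rw [Submodule.map_smul''] at this
      exact Submodule.smul_mono le_rfl le_top this

/-- Injections of flat modules occurring at the end of a long enough flat resolution are pure at
all multiples of a suitable element. -/
theorem IsNilQuasiChainRing.exists_isPureAt [Module.Flat R L] [Module.Flat R F] [Module.Flat R F']
    [Module.Flat R F''] (h : IsNilQuasiChainRing R) (hι : Function.Injective ι)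
    (hιd : Function.Exact ι d) (hd : Function.Exact d d') :
    ∃ c ∈ maximalIdeal R, c ^ 2 ≠ 0 ∧ ∀ a, IsPureAt ι c (c * a) := by
  by_cases hnp : HasNonprincipalAnnihilators R
  · obtain ⟨c, hc, hc2⟩ := h.exists_mem_maximalIdeal
    have huni := h.isQuasiChainRing.dvd_or_dvd hc2 (h.isNilpotent c hc)
    refine ⟨c, hc, hc2, fun a l f hlf => ?_⟩
    by_cases ha : c * a = 0
    · exact ⟨0, hι (by rw [map_smul, hlf, ha]; simp)⟩
    have hdf : (c * a) • d f = 0 := by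
      rw [← map_smul, ← hlf, map_smul, hιd.apply_apply_eq_zero, smul_zero]
    obtain ⟨l', hl'⟩ := h.exists_sub_mem hnp hι hιd hd
      (Module.Flat.mem_smul_top_of_smul_eq_zero (d := c * a) (K := maximalIdeal R)
        (fun z hz hu => ha ((IsUnit.mul_left_eq_zero hu).1 hz)) hdf)
    obtain ⟨b, hb, f', hf'⟩ := exists_smul_eq_of_mem_smul_top huni hl'
    obtain ⟨l'', hl''⟩ := h.exists_smul_eq hι huni (a := a) (l := l - a • l') (f := f') hb (by
      rw [map_sub, map_smul]
      linear_combination (norm := module) hlf + a • hf')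
    refine ⟨l' + l'', ?_⟩
    rw [smul_add, ← hl'', smul_sub, smul_smul]; abel
  · obtain ⟨c, hc, hc2, r, s, hrs, hs0, hs, hmin⟩ := h.exists_principal_annihilator hnp
    exact ⟨c, hc, hc2, isPureAt_of_principal_annihilator
      (h.isQuasiChainRing.dvd_or_dvd hc2 (h.isNilpotent c hc)) hι hrs hs0 (h.isNilpotent s hs) hmin⟩

end Exactness

/-! ### From purity at one element to a flat quotient -/

section FlatQuotient

open IsLocalRing TensorProduct

variable {R : Type u} [CommRing R] {L F : Type v} [AddCommGroup L] [Module R L]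
  [AddCommGroup F] [Module R F] {ι : L →ₗ[R] F}

theorem IsQuasiChainRing.mem_smul_top_of_isPureAt [IsLocalRing R] [Module.Flat R L]
    (h : IsQuasiChainRing R) {c : R} (hc2 : c ^ 2 ≠ 0) (hc : IsNilpotent c) (hp : ∀ a, IsPureAt ι c (c * a)) {I : Ideal R}
    (hI : h.sqZero ≤ I) {l : L} (hl : ι l ∈ I • (⊤ : Submodule R F)) :
    l ∈ I • (⊤ : Submodule R L) := by
  obtain ⟨a, ha, f, hf⟩ := exists_smul_eq_of_mem_smul_top (h.dvd_or_dvd hc2 hc) hl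
  obtain ⟨l', hl'⟩ := hp a l f hf
  have hann : l - a • l' ∈ I • (⊤ : Submodule R L) :=
    Module.Flat.mem_smul_top_of_smul_eq_zero (d := c) (K := I)
      (fun z hz => hI (h.sq_eq_zero_of_mul_eq_zero hc2 hz))
      (by rw [smul_sub, hl', smul_smul, sub_self])
  rw [← sub_add_cancel l (a • l')]
  exact add_mem hann (Submodule.smul_mem_smul ha trivial)

/-- If `ι` is pure with respect to all ideals containing `N`, and `N * N = ⊥`, then `ι` is pure with
respect to all ideals. -/
theorem mem_smul_top_of_mul_self_eq_bot [Module.Flat R F] {N : Ideal R} (hN : N * N = ⊥)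
    (hp : ∀ I : Ideal R, N ≤ I → ∀ l, ι l ∈ I • (⊤ : Submodule R F) →
      l ∈ I • (⊤ : Submodule R L)) (I : Ideal R) {l : L} (hl : ι l ∈ I • (⊤ : Submodule R F)) :
    l ∈ I • (⊤ : Submodule R L) := by
  have map_mem : ∀ (J : Ideal R) (x : L), x ∈ J • (⊤ : Submodule R L) →
      ι x ∈ J • (⊤ : Submodule R F) := by
    intro J x hx
    have := Submodule.mem_map_of_mem (f := ι) hx
    rw [Submodule.map_smul''] at this
    exact Submodule.smul_mono le_rfl le_top this
  have key : ∀ B : Ideal R, B.FG → B ≤ N → ∀ x : L, x ∈ B • (⊤ : Submodule R L) →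
      ι x ∈ I • (⊤ : Submodule R F) → x ∈ I • (⊤ : Submodule R L) := by
    rintro B ⟨s, rfl⟩
    classical
    induction s using Finset.induction_on with
    | empty =>
      intro _ x hx _
      have : x = 0 := by simpa using hx
      rw [this]; exact zero_mem _
    | insert d s _ ih =>
      intro hle x hx hxI
      rw [Finset.coe_insert, Ideal.span_insert] at hx hle
      have hd : d ∈ N := hle (Ideal.mem_sup_left (Ideal.mem_span_singleton_self d))
      have hs : Ideal.span (s : Set R) ≤ N := le_sup_right.trans hle
      rw [Submodule.sup_smul] at hx
      obtain ⟨y, hy, z, hz, rfl⟩ := Submodule.mem_sup.1 hx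
      rw [Submodule.ideal_span_singleton_smul] at hy
      obtain ⟨y, -, rfl⟩ := (Submodule.mem_smul_pointwise_iff_exists _ _ _).1 hy
      -- `K` contains `N` because `d * N ⊆ N * N = ⊥`, so the known purity applies to it.
      let K : Ideal R := Submodule.comap (LinearMap.mulLeft R d) (I ⊔ Ideal.span (s : Set R))
      have hyK : y ∈ K • (⊤ : Submodule R L) := by
        refine hp K (fun n hn => ?_) y (Module.Flat.mem_smul_top_of_smul_mem
          (I := I ⊔ Ideal.span (s : Set R)) (d := d) (fun w hw => hw) ?_)
        · have : d * n ∈ N * N := Ideal.mul_mem_mul hd hn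
          rw [hN, Ideal.mem_bot] at this
          change d * n ∈ I ⊔ Ideal.span (s : Set R)
          rw [this]; exact zero_mem _
        · have e : d • ι y = ι (d • y + z) - ι z := by rw [map_add, map_smul, add_sub_cancel_right]
          rw [e, Submodule.sup_smul]
          exact sub_mem (Submodule.mem_sup_left hxI) (Submodule.mem_sup_right (map_mem _ _ hz))
      have hdy : d • y ∈ (I ⊔ Ideal.span (s : Set R)) • (⊤ : Submodule R L) := by
        refine Submodule.smul_induction_on hyK (fun k hk m _ => ?_) (fun a b ha hb => ?_)
        · rw [smul_smul]; exact Submodule.smul_mem_smul hk trivial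
        · rw [smul_add]; exact add_mem ha hb
      rw [Submodule.sup_smul] at hdy
      obtain ⟨p, hp', q, hq, hpq⟩ := Submodule.mem_sup.1 hdy
      rw [← hpq, add_assoc] at hxI ⊢
      refine add_mem hp' (ih hs _ (add_mem hq hz) ?_)
      rw [map_add] at hxI
      exact ((Submodule.add_mem_iff_right _ (map_mem I p hp')).1 hxI)
  have hlN := hp (I ⊔ N) le_sup_right l (Submodule.smul_mono_left le_sup_left hl)
  rw [Submodule.sup_smul] at hlN
  obtain ⟨x, hx, y, hy, rfl⟩ := Submodule.mem_sup.1 hlN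
  refine add_mem hx ?_
  rw [map_add] at hl
  have hyI := (Submodule.add_mem_iff_right _ (map_mem I x hx)).1 hl
  have hfg : ∃ B : Ideal R, B.FG ∧ B ≤ N ∧ y ∈ B • (⊤ : Submodule R L) := by
    refine Submodule.smul_induction_on hy (fun n hn m _ => ?_) ?_
    · exact ⟨Ideal.span {n}, ⟨{n}, by simp⟩, by simpa [Ideal.span_le] using hn,
        Submodule.smul_mem_smul (Ideal.mem_span_singleton_self n) trivial⟩
    · rintro a b ⟨B, hB, hBN, ha⟩ ⟨C, hC, hCN, hb⟩
      exact ⟨B ⊔ C, Submodule.FG.sup hB hC, sup_le hBN hCN, add_mem (Submodule.smul_mono_left le_sup_left ha)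
        (Submodule.smul_mono_left le_sup_right hb)⟩
  obtain ⟨B, hB, hBN, hyB⟩ := hfg
  exact key B hB hBN y hyB hyI

/-- The quotient of a flat module by a pure submodule is flat. -/
theorem Module.Flat.quotient_range_of_pure [Module.Flat R F]
    (hp : ∀ (I : Ideal R) (l : L), ι l ∈ I • (⊤ : Submodule R F) → l ∈ I • (⊤ : Submodule R L)) :
    Module.Flat R (F ⧸ LinearMap.range ι) := by
  rw [Module.Flat.iff_lift_lsmul_comp_subtype_injective]
  intro I hI
  rw [injective_iff_map_eq_zero]
  intro z hz
  obtain ⟨z, rfl⟩ := LinearMap.lTensor_surjective I (LinearMap.range ι).mkQ_surjective z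
  have hnat : ∀ z : I ⊗[R] F, TensorProduct.lift ((LinearMap.lsmul R _).comp I.subtype)
      ((LinearMap.range ι).mkQ.lTensor I z) =
      (LinearMap.range ι).mkQ (TensorProduct.lift ((LinearMap.lsmul R F).comp I.subtype) z) := by
    intro z
    induction z with
    | zero => simp
    | tmul a f => simp
    | add a b ha hb => simp only [map_add, ha, hb]
  have hnat' : ∀ w : I ⊗[R] L, TensorProduct.lift ((LinearMap.lsmul R _).comp I.subtype)
      (ι.lTensor I w) = ι (TensorProduct.lift ((LinearMap.lsmul R L).comp I.subtype) w) := by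
    intro z
    induction z with
    | zero => simp
    | tmul a f => simp
    | add a b ha hb => simp only [map_add, ha, hb]
  have hmem : ∀ z : I ⊗[R] F, TensorProduct.lift ((LinearMap.lsmul R F).comp I.subtype) z ∈
      I • (⊤ : Submodule R F) := by
    intro z
    induction z with
    | zero => simp
    | tmul a f => exact Submodule.smul_mem_smul a.2 trivial
    | add a b ha hb => rw [map_add]; exact add_mem ha hb
  rw [hnat, Submodule.mkQ_apply, Submodule.Quotient.mk_eq_zero] at hz
  obtain ⟨l, hl⟩ := hz
  have hlI := hp I l (hl ▸ hmem z)
  have hw : ∃ w : I ⊗[R] L, TensorProduct.lift ((LinearMap.lsmul R L).comp I.subtype) w = l := by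
    refine Submodule.smul_induction_on hlI (fun a ha m _ => ⟨⟨a, ha⟩ ⊗ₜ m, by simp⟩) ?_
    rintro x y ⟨w, rfl⟩ ⟨w', rfl⟩
    exact ⟨w + w', map_add _ _ _⟩
  obtain ⟨w, rfl⟩ := hw
  rw [← hnat'] at hl
  rw [← (Module.Flat.iff_lift_lsmul_comp_subtype_injective.1 ‹_› hI) hl, ← LinearMap.comp_apply,
    ← LinearMap.lTensor_comp, LinearMap.range_mkQ_comp]
  simp

theorem IsNilQuasiChainRing.flat_quotient_range [IsLocalRing R] (h : IsNilQuasiChainRing R)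
    [Module.Flat R L] [Module.Flat R F] {F' F'' : Type v} [AddCommGroup F']
    [AddCommGroup F''] [Module R F'] [Module R F''] [Module.Flat R F'] [Module.Flat R F'']
    {d : F →ₗ[R] F'} {d' : F' →ₗ[R] F''} (hι : Function.Injective ι)
    (hιd : Function.Exact ι d) (hd : Function.Exact d d') :
    Module.Flat R (F ⧸ LinearMap.range ι) := by
  obtain ⟨c, hc, hc2, hp⟩ := h.exists_isPureAt hι hιd hd
  exact Module.Flat.quotient_range_of_pure fun I l hl =>
    mem_smul_top_of_mul_self_eq_bot h.isQuasiChainRing.sqZero_mul_sqZero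
      (fun I hI l hl => h.isQuasiChainRing.mem_smul_top_of_isPureAt hc2 (h.isNilpotent c hc) hp
        hI hl) I hl

end FlatQuotient

/-! ### Shortening flat resolutions -/

section Truncation

open IsLocalRing

variable {R : Type u} [CommRing R] {M : Type u} [AddCommGroup M] [Module R M]

/-- Quotients of a flat resolution that remain exact. -/
def FlatResolution.quotient {m n : ℕ} (C : FlatResolution R M m)
    (N : ∀ i, Submodule R (C.F i)) (hflat : ∀ i, Module.Flat R (C.F i ⧸ N i))
    (htop : ∀ i, n < i → N i = ⊤) (hε : N 0 ≤ LinearMap.ker C.ε)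
    (hle : ∀ i, N (i + 1) ≤ (N i).comap (C.d i))
    (hge : ∀ i, (N i).comap (C.d i) ≤ LinearMap.range (C.d (i + 1)) ⊔ N (i + 1)) :
    FlatResolution R M n where
  F i := ModuleCat.of R (C.F i ⧸ N i)
  d i := (N (i + 1)).mapQ (N i) (C.d i) (hle i)
  ε := (N 0).liftQ C.ε hε
  flat := hflat
  subsingleton_of_lt i hi := Submodule.Quotient.subsingleton_iff.2 (htop i hi)
  surjective_augmentation := by
    intro m
    obtain ⟨x, rfl⟩ := C.surjective_augmentation m
    exact ⟨Submodule.Quotient.mk x, rfl⟩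
  exact_augmentation := by
    intro x
    obtain ⟨x, rfl⟩ := Submodule.Quotient.mk_surjective _ x
    constructor
    · intro hx
      obtain ⟨y, rfl⟩ := (C.exact_augmentation x).1 hx
      exact ⟨Submodule.Quotient.mk y, rfl⟩
    · rintro ⟨y, hy⟩
      obtain ⟨y, rfl⟩ := Submodule.Quotient.mk_surjective _ y
      rw [← hy]
      exact C.exact_augmentation.apply_apply_eq_zero y
  exact_differential i := by
    intro x
    obtain ⟨x, rfl⟩ := Submodule.Quotient.mk_surjective _ x
    constructor
    · intro hx
      obtain ⟨_, ⟨y, rfl⟩, z, hz, hyz⟩ :=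
        Submodule.mem_sup.1 (hge i ((Submodule.Quotient.mk_eq_zero (N i) (x := C.d i x)).1 hx))
      refine ⟨Submodule.Quotient.mk y, ?_⟩
      refine (Submodule.Quotient.eq _).2 ?_
      rw [← hyz, sub_add_cancel_left]
      exact neg_mem hz
    · rintro ⟨y, hy⟩
      obtain ⟨y, rfl⟩ := Submodule.Quotient.mk_surjective _ y
      rw [← hy]
      refine (Submodule.Quotient.mk_eq_zero _).2 ?_
      rw [(C.exact_differential i).apply_apply_eq_zero]
      exact zero_mem _

theorem FlatResolution.truncate {n : ℕ} (C : FlatResolution R M (n + 1))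
    (hflat : Module.Flat R (C.F n ⧸ LinearMap.range (C.d n))) :
    Nonempty (FlatResolution R M n) := by
  -- The degree `n` term becomes the cokernel of `d n`; lower terms are kept and higher ones killed.
  let N : ∀ i, Submodule R (C.F i) := fun i =>
    if i < n then ⊥ else if i = n then LinearMap.range (C.d i) else ⊤
  have hlt : ∀ i, i < n → N i = ⊥ := fun i hi => if_pos hi
  have heq : N n = LinearMap.range (C.d n) := by simp [N]
  have hgt : ∀ i, n < i → N i = ⊤ := fun i hi => by
    simp only [N]; rw [if_neg (by omega), if_neg (by omega)]
  have hd : ∀ i, ∀ x ∈ LinearMap.range (C.d (i + 1)), C.d i x = 0 := by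
    rintro i _ ⟨y, rfl⟩; exact (C.exact_differential i).apply_apply_eq_zero y
  refine ⟨C.quotient N (fun i => ?_) hgt ?_ (fun i => ?_) (fun i => ?_)⟩
  · rcases lt_trichotomy i n with hi | rfl | hi
    · have := C.flat i
      exact Module.Flat.of_linearEquiv (Submodule.quotEquivOfEqBot _ (hlt i hi))
    · rw [heq]; exact hflat
    · have : Subsingleton (C.F i ⧸ N i) := Submodule.Quotient.subsingleton_iff.2 (hgt i hi)
      infer_instance
  · rcases Nat.eq_zero_or_pos n with rfl | hn
    · rw [heq]; rintro _ ⟨y, rfl⟩; exact C.exact_augmentation.apply_apply_eq_zero y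
    · rw [hlt 0 hn]; exact bot_le
  · rcases lt_trichotomy (i + 1) n with hi | rfl | hi
    · rw [hlt _ hi]; exact bot_le
    · intro x hx
      rw [heq] at hx
      rw [Submodule.mem_comap, hd i x hx]; exact zero_mem _
    · rcases (Nat.lt_succ_iff.1 hi).eq_or_lt with rfl | hi
      · intro x _
        rw [Submodule.mem_comap, heq]; exact ⟨x, rfl⟩
      · rw [hgt i hi]; exact le_top
  · rcases lt_or_ge i n with hi | hi
    · intro x hx
      rw [hlt i hi, Submodule.mem_comap, Submodule.mem_bot] at hx
      exact Submodule.mem_sup_left ((C.exact_differential i x).1 hx)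
    · rw [hgt (i + 1) (by omega), sup_top_eq]; exact le_top

theorem FlatResolution.injective_d {n : ℕ} (C : FlatResolution R M n) {i : ℕ} (hi : n ≤ i + 1) :
    Function.Injective (C.d i) := by
  have := C.subsingleton_of_lt (i + 2) (by omega)
  rw [injective_iff_map_eq_zero]
  intro x hx
  obtain ⟨y, rfl⟩ := (C.exact_differential i x).1 hx
  rw [Subsingleton.elim y 0, map_zero]

/-- Length two is the limit because `flat_quotient_range` needs two further flat terms after the
injection. -/
theorem IsNilQuasiChainRing.nonempty_flatResolution_two [IsLocalRing R]
    (h : IsNilQuasiChainRing R) (k : ℕ) (C : FlatResolution R M (k + 2)) :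
    Nonempty (FlatResolution R M 2) := by
  induction k with
  | zero => exact ⟨C⟩
  | succ k ih =>
    have := C.flat
    obtain ⟨C'⟩ := C.truncate (n := k + 2) (h.flat_quotient_range (C.injective_d (by omega))
      (C.exact_differential (k + 1)) (C.exact_differential k))
    exact ih C'

end Truncation

/-! ### Cyclic modules of infinite flat dimension -/

section Cyclic

open IsLocalRing

variable {R : Type u} [CommRing R]

theorem exists_finite_free_lift {M : Type u} [AddCommGroup M] [Module R M] {I : Ideal R} {x : M}
    (hx : x ∈ I • (⊤ : Submodule R M)) :
    ∃ (N : Type u) (_ : AddCommGroup N) (_ : Module R N) (_ : Module.Finite R N)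
      (_ : Module.Free R N) (p : N →ₗ[R] M), ∃ r ∈ I • (⊤ : Submodule R N), p r = x := by
  refine Submodule.smul_induction_on hx (fun a ha m _ => ?_) ?_
  · exact ⟨R, inferInstance, inferInstance, inferInstance, inferInstance,
      LinearMap.toSpanSingleton R M m, a • 1, Submodule.smul_mem_smul ha trivial, by simp⟩
  · rintro x y ⟨N, _, _, _, _, p, r, hr, rfl⟩ ⟨N', _, _, _, _, p', r', hr', rfl⟩
    refine ⟨N × N', inferInstance, inferInstance, inferInstance, inferInstance, p.coprod p',
      (r, r'), ?_, by simp⟩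
    have h1 := Submodule.mem_map_of_mem (f := LinearMap.inl R N N') hr
    have h2 := Submodule.mem_map_of_mem (f := LinearMap.inr R N N') hr'
    rw [Submodule.map_smul''] at h1 h2
    have := add_mem (Submodule.smul_mono le_rfl le_top h1) (Submodule.smul_mono le_rfl le_top h2)
    simpa using this

theorem LinearMap.apply_mem_mul_of_mem_smul_top {N : Type u} [AddCommGroup N] [Module R N]
    {I J : Ideal R} {θ : N →ₗ[R] R} (hθ : ∀ n, θ n ∈ J) {r : N}
    (hr : r ∈ I • (⊤ : Submodule R N)) : θ r ∈ I * J := by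
  refine Submodule.smul_induction_on hr (fun a ha n _ => ?_) (fun x y hx hy => ?_)
  · rw [map_smul]; exact Ideal.mul_mem_mul ha (hθ n)
  · rw [map_add]; exact add_mem hx hy

/-- If `R ⧸ (a)` has a flat resolution of length two, then the annihilator of `a` is idempotent:
this is the case where its square is zero. -/
theorem eq_zero_of_flatResolution_two [IsLocalRing R] {a : R} (ha : a ∈ maximalIdeal R)
    (hann : ∀ x y, a * x = 0 → a * y = 0 → x * y = 0)
    (C : FlatResolution R (R ⧸ Ideal.span {a}) 2) {x : R} (hx : a * x = 0) : x = 0 := by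
  have := C.flat
  set A : Ideal R := LinearMap.ker (LinearMap.mulLeft R a) with hA
  have memA : ∀ y, y ∈ A ↔ a * y = 0 := fun y => by simp [hA]
  have hAA : A * A = ⊥ := by
    rw [eq_bot_iff, Ideal.mul_le]
    exact fun y hy z hz => hann y z ((memA y).1 hy) ((memA z).1 hz)
  obtain ⟨f₀, hf₀⟩ := C.surjective_augmentation (Ideal.Quotient.mk _ 1)
  obtain ⟨f₁, hf₁⟩ := (C.exact_augmentation (a • f₀)).1 (by
    rw [map_smul, hf₀]
    exact Ideal.Quotient.eq_zero_iff_mem.2 (by simp))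
  obtain ⟨w, hw⟩ := (C.exact_differential 0 (x • f₁)).1 (by
    rw [map_smul, hf₁, smul_smul, mul_comm, hx, zero_smul])
  have hwA : w ∈ A • (⊤ : Submodule R (C.F 2)) :=
    Module.Flat.mem_smul_top_of_smul_eq_zero (fun z hz => (memA z).2 hz)
      (C.injective_d (i := 1) (by omega) (by
        rw [map_smul, hw, smul_smul, hx, zero_smul, map_zero]))
  obtain ⟨N, _, _, _, _, p, r, hr, rfl⟩ := exists_finite_free_lift hwA
  -- Two factorizations through free modules give a free model of the end of the resolution,
  -- comparable with multiplication by `a` on `R`. The induced map `θ` into `A` sends `(r, x)` both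
  -- into `A * A = ⊥` and to `-e * x` with `e` a unit.
  let φ : (N × R) →ₗ[R] C.F 1 := (-(C.d 1 ∘ₗ p)).coprod (LinearMap.toSpanSingleton R _ f₁)
  have hφ : φ (r, x) = 0 := by simp [φ, hw]
  have hdφ : ∀ v, C.d 0 (φ v) = v.2 • a • f₀ := fun v => by
    simp [φ, hf₁, (C.exact_differential 0).apply_apply_eq_zero (p v.1)]
  obtain ⟨k, α, y, hy, hα⟩ := Module.Flat.exists_factorization_of_apply_eq_zero_of_free hφ
  let Φ : ((Fin k →₀ R) × R) →ₗ[R] C.F 0 :=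
    (C.d 0 ∘ₗ y).coprod (LinearMap.toSpanSingleton R _ f₀)
  let f : (N × R) →ₗ[R] (Fin k →₀ R) × R := α.prod (-(a • LinearMap.snd R N R))
  have hΦ : Φ ∘ₗ f = 0 := by
    refine LinearMap.ext fun v => ?_
    have : y (α v) = φ v := by rw [hy]; rfl
    change C.d 0 (y (α v)) + (-(a • v.2)) • f₀ = 0
    rw [this, hdφ, smul_smul, smul_eq_mul, mul_comm, neg_smul, add_neg_cancel]
  obtain ⟨k', β, y', hy', hβ⟩ := Module.Flat.exists_factorization_of_comp_eq_zero_of_free hΦ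
  obtain ⟨ψ', hψ'⟩ := Module.projective_lifting_property (Ideal.span {a}).mkQ (C.ε ∘ₗ y')
    (Submodule.mkQ_surjective _)
  let ψ : ((Fin k →₀ R) × R) →ₗ[R] R := ψ' ∘ₗ β
  have hψ : ∀ v, (Ideal.span {a}).mkQ (ψ v) = C.ε (Φ v) := fun v => by
    rw [hy']; exact LinearMap.congr_fun hψ' (β v)
  have hψf : ∀ v, ψ (f v) = 0 := fun v => by
    have : β (f v) = 0 := LinearMap.congr_fun hβ v
    simp [ψ, this]
  let χ : (Fin k →₀ R) →ₗ[R] R := ψ ∘ₗ LinearMap.inl R _ R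
  have hχ : ∀ u, χ u ∈ LinearMap.range (LinearMap.mulLeft R a) := fun u => by
    have h0 : (Ideal.span {a}).mkQ (χ u) = 0 := by
      rw [show χ u = ψ (u, 0) from rfl, hψ]
      simp [Φ, C.exact_augmentation.apply_apply_eq_zero]
    rw [Submodule.mkQ_apply, Submodule.Quotient.mk_eq_zero, Ideal.mem_span_singleton] at h0
    obtain ⟨t, ht⟩ := h0
    exact ⟨t, ht.symm⟩
  obtain ⟨σ, hσ⟩ := Module.projective_lifting_property (LinearMap.mulLeft R a).rangeRestrict
    (χ.codRestrict _ hχ) (LinearMap.surjective_rangeRestrict _)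
  have hσ' : ∀ u, a * σ u = χ u := fun u => congr_arg Subtype.val (LinearMap.congr_fun hσ u)
  let e : R := ψ (0, 1)
  have he : IsUnit e := by
    have h1 : (Ideal.span {a}).mkQ e = Ideal.Quotient.mk _ 1 := by
      rw [hψ, ← hf₀]; simp [Φ]
    have h2 : e - 1 ∈ Ideal.span {a} := (Submodule.Quotient.eq _).1 h1
    by_contra hu
    have h3 : (1 : R) ∈ maximalIdeal R := by
      have := sub_mem (show e ∈ maximalIdeal R from hu)
        ((Ideal.span_singleton_le_iff_mem _).2 ha h2)
      rwa [sub_sub_cancel] at this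
    exact (Ideal.ne_top_iff_one _).1 (maximalIdeal.isMaximal R).ne_top h3
  let θ : (N × R) →ₗ[R] R := σ ∘ₗ α - e • LinearMap.snd R N R
  have hθ : ∀ v, θ v ∈ A := fun v => by
    rw [memA]
    have h1 : ψ (f v) = χ (α v) - a * v.2 * e := by
      have : f v = LinearMap.inl R _ R (α v) - (a * v.2) • ((0 : Fin k →₀ R), (1 : R)) := by
        ext <;> simp [f]
      rw [this, map_sub, map_smul]; rfl
    rw [hψf, ← hσ'] at h1
    change a * (σ (α v) - e * v.2) = 0
    linear_combination -h1
  have hθ1 : θ (r, x) = 0 := by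
    have hmem : ((r, x) : N × R) ∈ A • (⊤ : Submodule R (N × R)) := by
      have h1 := Submodule.mem_map_of_mem (f := LinearMap.inl R N R) hr
      rw [Submodule.map_smul''] at h1
      have h2 : x • ((0 : N), (1 : R)) ∈ A • (⊤ : Submodule R (N × R)) :=
        Submodule.smul_mem_smul ((memA x).2 hx) trivial
      have := add_mem (Submodule.smul_mono le_rfl le_top h1) h2
      simpa using this
    have := LinearMap.apply_mem_mul_of_mem_smul_top hθ hmem
    rwa [hAA] at this
  have : e * x = 0 := by
    have h1 : θ (r, x) = σ (α (r, x)) - e * x := rfl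
    rw [hθ1, hα, map_zero] at h1
    linear_combination h1
  exact he.mul_right_eq_zero.1 this

theorem IsNilQuasiChainRing.wgd_eq_top [IsLocalRing R] (h : IsNilQuasiChainRing R) :
    wgd R = ⊤ := by
  obtain ⟨a, ha, ha2⟩ := h.exists_mem_maximalIdeal
  have hempty : ∀ n, ¬ Nonempty (FlatResolution R (R ⧸ Ideal.span {a}) n) := by
    rintro n ⟨C⟩
    -- Padding by zero modules ensures length at least two.
    let C₂ : FlatResolution R (R ⧸ Ideal.span {a}) (n + 2) :=
      { C with subsingleton_of_lt := fun i hi => C.subsingleton_of_lt i (by omega) }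
    obtain ⟨C'⟩ := h.nonempty_flatResolution_two n C₂
    have hq := h.isQuasiChainRing
    obtain ⟨y, hy, hy'⟩ := h.exists_mul_eq_zero_and_ne ha (x := 1) (fun h0 => ha2 (by
      rw [one_mul] at h0; rw [h0]; simp))
    rw [one_mul] at hy hy'
    exact hy' (eq_zero_of_flatResolution_two ha (fun x y hx hy =>
      hq.mul_eq_zero (hq.sq_eq_zero_of_mul_eq_zero ha2 hx)
        (hq.sq_eq_zero_of_mul_eq_zero ha2 hy)) C' hy)
  rw [wgd, eq_top_iff]
  refine le_iSup_of_le (ModuleCat.of R (R ⧸ Ideal.span {a})) ?_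
  rw [moduleWgd]
  exact le_iInf₂ fun n hn => absurd hn (hempty n)

end Cyclic

theorem mainTheorem4 (R : Type u) [CommRing R] [IsLocalRing R]
    (hGauss : IsGaussianRing R)
    (hnil : nilradical R = IsLocalRing.maximalIdeal R)
    (hnot : ¬ IsNilpotent (IsLocalRing.maximalIdeal R)) :
    wgd R = ⊤ :=
  (hGauss.isQuasiChainRing.isNilQuasiChainRing
    (fun x hx => by rwa [← hnil, mem_nilradical] at hx) hnot).wgd_eq_top
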